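/- Let $q=3^m$ with $m\ge 3$ odd, let $n=q+1$, and let $\beta$ be a primitive $n$-th root of unity in an extension field of $\mathbb{F}_q$. For an integer $i$ let $m_i(x)$ be the minimal polynomial of $\beta^i$ over $\mathbb{F}_q$. Let $\mathcal{C}=\mathcal{C}_{(q,q+1,3,4)}$ be the BCH code of length $n$ over $\mathbb{F}_q$ with generator polynomial $\operatorname{lcm}(m_4(x),m_5(x))$, that is, the set of all $(c_0,\dots,c_{n-1})\in\mathbb{F}_q^n$ for which the class of $c_0+c_1x+\cdots+c_{n-1}x^{n-1}$ lies in the ideal of $\mathbb{F}_q[x]/(x^n-1)$ generated by $\operatorname{lcm}(m_4(x),m_5(x))$. A linear code of length $n$, dimension $k$ and minimum Hamming distance $d$ is called an $[n,k,d]$ code; it is almost MDS (AMDS) if $d=n-k$, and near MDS if both the code and its dual with respect to the Euclidean inner product are AMDS. Then $\mathcal{C}$ is a near MDS code with parameters $[q+1,\,q-3,\,4]$. -/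

import Mathlib

open Polynomial

noncomputable section

/-- The linear map `(c₀, …, c_{n-1}) ↦ c₀ + c₁ x + ⋯ + c_{n-1} x^{n-1}` from `Fⁿ` to
`F[x] / (x^n - 1)`. -/
def wordToQuotient (F : Type*) [Field F] (n : ℕ) :
    (Fin n → F) →ₗ[F] (F[X] ⧸ Ideal.span {(X ^ n - 1 : F[X])}) :=
  (Ideal.Quotient.mkₐ F (Ideal.span {(X ^ n - 1 : F[X])})).toLinearMap ∘ₗ
    ∑ i : Fin n, Polynomial.monomial (i : ℕ) ∘ₗ LinearMap.proj i

/-- The cyclic code of length `n` generated by `g`: the words whose polynomial, modulo `x^n - 1`,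
lies in the ideal of `F[x] / (x^n - 1)` generated by `g`. -/
def cyclicCode {F : Type*} [Field F] (n : ℕ) (g : F[X]) : Submodule F (Fin n → F) :=
  ((Ideal.span {Ideal.Quotient.mk (Ideal.span {(X ^ n - 1 : F[X])}) g}).restrictScalars F).comap
    (wordToQuotient F n)

/-- `lcm (m_h, m_{h+1}, …, m_{h+δ-2})`, where `m_i` is the minimal polynomial of `β^i` over `F`
and the subscripts are read modulo `n`. -/
def bchGenerator (F : Type*) [Field F] {E : Type*} [Field E] [Algebra F E] (β : E)
    (n δ h : ℕ) : F[X] :=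
  letI : DecidableEq F := Classical.decEq F
  letI : NormalizedGCDMonoid F[X] := UniqueFactorizationMonoid.toNormalizedGCDMonoid F[X]
  (Finset.range (δ - 1)).lcm fun i => minpoly F (β ^ ((h + i) % n))

/-- The BCH code over `F` of length `n` and designed distance `δ`, with offset `h`, with respect
to the primitive `n`-th root of unity `β`. -/
def bchCode (F : Type*) [Field F] {E : Type*} [Field E] [Algebra F E] (β : E)
    (n δ h : ℕ) : Submodule F (Fin n → F) :=
  cyclicCode n (bchGenerator F β n δ h)

/-- The dual code, with respect to the Euclidean inner product `∑ i, c i * y i`. -/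
def dualCode {F : Type*} [Field F] {n : ℕ} (C : Submodule F (Fin n → F)) :
    Submodule F (Fin n → F) where
  carrier := {y | ∀ c ∈ C, ∑ i, c i * y i = 0}
  zero_mem' := by
    intro c _
    simp
  add_mem' := by
    intro y z hy hz c hc
    simp only [Pi.add_apply, mul_add, Finset.sum_add_distrib, hy c hc, hz c hc, add_zero]
  smul_mem' := by
    intro a y hy c hc
    simp only [Pi.smul_apply, smul_eq_mul, mul_left_comm _ a, ← Finset.mul_sum, hy c hc, mul_zero]

/-- `d` is the smallest Hamming distance between distinct codewords of `C`. -/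
def IsMinDistance {F : Type*} [Field F] [DecidableEq F] {n : ℕ}
    (C : Submodule F (Fin n → F)) (d : ℕ) : Prop :=
  IsLeast {t : ℕ | ∃ a ∈ C, ∃ b ∈ C, a ≠ b ∧ hammingDist a b = t} d

/-- `C` is an `[n, k, d]` linear code. -/
def IsLinearCode {F : Type*} [Field F] [DecidableEq F] (n k d : ℕ)
    (C : Submodule F (Fin n → F)) : Prop :=
  Module.finrank F C = k ∧ IsMinDistance C d

/-- Almost MDS: `C` is an `[n, k, d]` code with `d = n - k` (written without subtraction). -/
def IsAMDS {F : Type*} [Field F] [DecidableEq F] {n : ℕ}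
    (C : Submodule F (Fin n → F)) : Prop :=
  ∃ k d : ℕ, IsLinearCode n k d C ∧ d + k = n

/-- Near MDS: both `C` and its dual are almost MDS. -/
def IsNearMDS {F : Type*} [Field F] [DecidableEq F] {n : ℕ}
    (C : Submodule F (Fin n → F)) : Prop :=
  IsAMDS C ∧ IsAMDS (dualCode C)

end

/-! In the coordinate x = β^j, a dual word is A x^4 + A' x⁻⁴ + D x^5 + D' x⁻⁵; times x^5 it becomes
a bilinear form in x and x^9. Hence four zeros have the same cross ratio t as their ninth powers, so
t^9 = t. Inversion x^q = x⁻¹ also preserves cross ratios, so t^q = t. For odd m this forces t into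
F_3, and distinctness leaves t = -1 (`harmonic_of_bilinear_frobenius`). Five points cannot be
harmonic in this way, so there are at most four zeros (`card_le_four_of_bilinear_frobenius`): the
dual has dimension 4 and distance at least q - 3.

For the code itself, x⁻⁵ (x - a)(x - b)^9 combines the parity checks and isolates one coordinate of
a word of weight at most 3 (`four_le_hammingNorm`). Both bounds are attained through the fourth
roots of unity, available because 4 ∣ q + 1. -/

theorem isMinDistance_iff_hammingNorm {F : Type*} [Field F] [DecidableEq F] {n : ℕ}
    (C : Submodule F (Fin n → F)) (d : ℕ) :
    IsMinDistance C d ↔ (∃ c ∈ C, c ≠ 0 ∧ hammingNorm c = d) ∧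
      ∀ c ∈ C, c ≠ 0 → d ≤ hammingNorm c := by
  constructor
  · rintro ⟨⟨a, ha, b, hb, hab, h⟩, hlb⟩
    refine ⟨⟨b - a, C.sub_mem hb ha, sub_ne_zero.2 hab.symm, ?_⟩, fun c hc h0 => ?_⟩
    · rw [← neg_add_eq_sub, ← hammingDist_eq_hammingNorm, h]
    · exact hlb ⟨c, hc, 0, C.zero_mem, h0, hammingDist_zero_right c⟩
  · rintro ⟨⟨c, hc, h0, h⟩, hlb⟩
    refine ⟨⟨c, hc, 0, C.zero_mem, h0, by rw [hammingDist_zero_right, h]⟩, ?_⟩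
    rintro t ⟨a, ha, b, hb, hab, rfl⟩
    rw [hammingDist_eq_hammingNorm, neg_add_eq_sub]
    exact hlb _ (C.sub_mem hb ha) (sub_ne_zero.2 hab.symm)

theorem hammingNorm_add_card_zeros {F : Type*} [Field F] [DecidableEq F] {n : ℕ}
    (c : Fin n → F) : hammingNorm c + (Finset.univ.filter fun j => c j = 0).card = n := by
  have := Finset.card_filter_add_card_filter_not (s := (Finset.univ : Finset (Fin n)))
    (fun j => c j = 0)
  simp only [Finset.card_univ, Fintype.card_fin] at this
  rw [add_comm]
  exact this

/-! ### Euclidean duality as orthogonality for the identity bilinear form. -/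

section Dual

variable {F : Type*} [Field F] {n : ℕ}

theorem dualCode_eq_orthogonal (C : Submodule F (Fin n → F)) :
    dualCode C = (Matrix.toBilin' (1 : Matrix (Fin n) (Fin n) F)).orthogonal C := by
  ext y
  simp only [LinearMap.BilinForm.mem_orthogonal_iff, Matrix.toBilin'_apply', Matrix.one_mulVec]
  rfl

theorem toBilin'_one_nondegenerate :
    (Matrix.toBilin' (1 : Matrix (Fin n) (Fin n) F)).Nondegenerate :=
  LinearMap.BilinForm.nondegenerate_toBilin'_of_det_ne_zero' _ (by simp)

theorem finrank_dualCode (C : Submodule F (Fin n → F)) :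
    Module.finrank F (dualCode C) = n - Module.finrank F C := by
  rw [dualCode_eq_orthogonal, LinearMap.BilinForm.finrank_orthogonal toBilin'_one_nondegenerate]
  simp

theorem dualCode_dualCode (C : Submodule F (Fin n → F)) : dualCode (dualCode C) = C := by
  rw [dualCode_eq_orthogonal, dualCode_eq_orthogonal]
  refine LinearMap.BilinForm.orthogonal_orthogonal toBilin'_one_nondegenerate ?_ C
  intro x y h
  rw [Matrix.toBilin'_apply', Matrix.one_mulVec] at h ⊢
  rwa [dotProduct_comm]

theorem mem_dualCode_span_range {k : ℕ} (r : Fin k → Fin n → F) (c : Fin n → F) :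
    c ∈ dualCode (Submodule.span F (Set.range r)) ↔ ∀ l, ∑ j, r l j * c j = 0 := by
  constructor
  · exact fun h l => h _ (Submodule.subset_span ⟨l, rfl⟩)
  · intro h v hv
    induction hv using Submodule.span_induction with
    | mem x hx =>
      obtain ⟨l, rfl⟩ := hx
      exact h l
    | zero => simp
    | add x y _ _ hx hy => simp only [Pi.add_apply, add_mul, Finset.sum_add_distrib, hx, hy, add_zero]
    | smul a x _ hx => simp only [Pi.smul_apply, smul_eq_mul, mul_assoc, ← Finset.mul_sum, hx, mul_zero]

end Dual

/-! ### Cyclic and BCH codes by parity checks. -/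

section Cyclic

variable {F : Type*} [Field F]

/-- Since g divides X^n - 1, changing a representative modulo X^n - 1 does not affect divisibility
by g. -/
theorem mem_cyclicCode_iff {n : ℕ} {g : F[X]} (hg : g ∣ X ^ n - 1) (c : Fin n → F) :
    c ∈ cyclicCode n g ↔ g ∣ ∑ i : Fin n, monomial (i : ℕ) (c i) := by
  have h : wordToQuotient F n c =
      Ideal.Quotient.mk (Ideal.span {(X ^ n - 1 : F[X])}) (∑ i : Fin n, monomial (i : ℕ) (c i)) := by
    simp [wordToQuotient]
  have h' : c ∈ cyclicCode n g ↔ wordToQuotient F n c ∈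
      Ideal.span {Ideal.Quotient.mk (Ideal.span {(X ^ n - 1 : F[X])}) g} := Iff.rfl
  rw [h', h, Ideal.mem_span_singleton]
  constructor
  · rintro ⟨w, hw⟩
    obtain ⟨w, rfl⟩ := Ideal.Quotient.mk_surjective w
    rw [← map_mul, Ideal.Quotient.eq, Ideal.mem_span_singleton] at hw
    have := (hg.trans hw).add (dvd_mul_right g w)
    rwa [sub_add_cancel] at this
  · exact fun h => map_dvd _ h

theorem mem_bchCode_iff {E : Type*} [Field E] [Algebra F E] {β : E} {n : ℕ} (hβ : β ^ n = 1)
    (hn : n ≠ 0) (δ h : ℕ) (c : Fin n → F) :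
    c ∈ bchCode F β n δ h ↔
      ∀ l < δ - 1, ∑ j : Fin n, algebraMap F E (c j) * (β ^ (j : ℕ)) ^ ((h + l) % n) = 0 := by
  have hint (l : ℕ) : IsIntegral F (β ^ l) := by
    have : IsIntegral F β := ⟨X ^ n - 1, monic_X_pow_sub_C 1 hn, by simp [hβ]⟩
    exact this.pow l
  have hdvd (p : F[X]) : bchGenerator F β n δ h ∣ p ↔
      ∀ l < δ - 1, aeval (β ^ ((h + l) % n)) p = 0 := by
    let _ : DecidableEq F := Classical.decEq F
    let _ : NormalizedGCDMonoid F[X] := UniqueFactorizationMonoid.toNormalizedGCDMonoid F[X]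
    rw [bchGenerator, Finset.lcm_dvd_iff]
    simp only [Finset.mem_range]
    exact forall₂_congr fun l _ => minpoly.dvd_iff
  rw [bchCode, mem_cyclicCode_iff, hdvd]
  · refine forall₂_congr fun l _ => ?_
    simp only [map_sum, aeval_monomial, ← pow_mul, mul_comm]
  · rw [hdvd]
    intro l _
    simp [← pow_mul, mul_comm _ n, pow_mul β n, hβ]

end Cyclic

/-! ### Frobenius and cross ratios in characteristic three. -/

theorem two_ne_zero_of_charP_three (E : Type*) [Field E] [CharP E 3] : (2 : E) ≠ 0 := by
  intro h
  have h3 : (3 : E) = 0 := by exact_mod_cast CharP.cast_eq_zero E 3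
  exact one_ne_zero (by linear_combination h3 - h : (1 : E) = 0)

/-- X^q - X already splits over F, so an extension contributes no further roots. -/
theorem mem_range_algebraMap_of_pow_card_eq {F E : Type*} [Field F] [Fintype F] [Field E]
    [Algebra F E] {e : E} (he : e ^ Fintype.card F = e) : ∃ a : F, algebraMap F E a = e := by
  have hmonic : (X ^ Fintype.card F - X : F[X]).Monic :=
    monic_X_pow_sub (by rw [degree_X]; exact_mod_cast Fintype.one_lt_card)
  have hroots := FiniteField.roots_X_pow_card_sub_X F
  have hprod := prod_multiset_X_sub_C_of_monic_of_roots_card_eq hmonic (by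
    rw [hroots, FiniteField.X_pow_card_sub_X_natDegree_eq F Fintype.one_lt_card]; rfl)
  rw [hroots] at hprod
  have h0 : aeval e (∏ a : F, (X - C a)) = 0 := by
    have : (∏ a : F, (X - C a)) = X ^ Fintype.card F - X := hprod
    rw [this]
    simp [he]
  rw [map_prod, Finset.prod_eq_zero_iff] at h0
  obtain ⟨a, -, ha⟩ := h0
  exact ⟨a, by simpa using (sub_eq_zero.1 (by simpa using ha) : e = algebraMap F E a).symm⟩

/-- Points `x₁, …, x₄` such that `(xᵢ, yᵢ)` lie on a common nonzero bilinear form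
have the same cross ratio as `y₁, …, y₄`. -/
theorem cross_ratio_eq_of_bilinear {E : Type*} [Field E] {A B C D : E}
    (h : ¬ (A = 0 ∧ B = 0 ∧ C = 0 ∧ D = 0)) (x y : Fin 4 → E)
    (hxy : ∀ k, A + B * x k + C * y k + D * (x k * y k) = 0) :
    (x 0 - x 1) * (x 2 - x 3) * ((y 0 - y 2) * (y 1 - y 3)) =
      (x 0 - x 2) * (x 1 - x 3) * ((y 0 - y 1) * (y 2 - y 3)) := by
  -- The coefficient vector (A, B, C, D) lies in the kernel; the determinant expands to the
  -- difference of the two sides, so the form may be degenerate.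
  have hdet : (Matrix.of fun k => ![1, x k, y k, x k * y k] : Matrix (Fin 4) (Fin 4) E).det = 0 := by
    rw [← Matrix.exists_mulVec_eq_zero_iff]
    refine ⟨![A, B, C, D], fun h0 => h ?_, ?_⟩
    · exact ⟨congrFun h0 0, congrFun h0 1, congrFun h0 2, congrFun h0 3⟩
    · ext k
      simp only [Matrix.mulVec, dotProduct, Fin.sum_univ_four, Matrix.of_apply, Pi.zero_apply]
      simp only [Matrix.cons_val]
      linear_combination hxy k
  rw [Matrix.det_succ_row_zero] at hdet
  simp only [Fin.sum_univ_four, Matrix.det_fin_three, Matrix.submatrix_apply, Matrix.of_apply] at hdet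
  simp [Fin.succAbove, Fin.lt_def] at hdet
  linear_combination hdet

/-- This is F_9 ∩ F_{3^m} = F_3: writing 3^m = 9^k · 3, the factor 9^k acts trivially on t. -/
theorem cube_eq_of_pow_nine_eq {E : Type*} [Monoid E] {t : E} {m : ℕ} (hm : Odd m)
    (h9 : t ^ 9 = t) (hq : t ^ 3 ^ m = t) : t ^ 3 = t := by
  obtain ⟨k, rfl⟩ := hm
  have h (l : ℕ) : t ^ 9 ^ l = t := by
    induction l with
    | zero => simp
    | succ l ih => rw [pow_succ, pow_mul, ih, h9]
  rwa [pow_succ, pow_mul, pow_mul, show 3 ^ 2 = 9 from rfl, h] at hq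

theorem harmonic_of_bilinear_frobenius {E : Type*} [Field E] [CharP E 3] {m : ℕ} (hm : Odd m)
    {A B C D : E} (h : ¬ (A = 0 ∧ B = 0 ∧ C = 0 ∧ D = 0)) (x : Fin 4 → E)
    (hinj : Function.Injective x) (hunit : ∀ k, x k ^ (3 ^ m + 1) = 1)
    (hx : ∀ k, A + B * x k + C * x k ^ 9 + D * x k ^ 10 = 0) :
    (x 0 - x 1) * (x 2 - x 3) + (x 0 - x 2) * (x 1 - x 3) = 0 := by
  have : Fact (Nat.Prime 3) := ⟨Nat.prime_three⟩
  have hne {k l : Fin 4} (hkl : k ≠ l) : x k - x l ≠ 0 := sub_ne_zero.2 (hinj.ne hkl)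
  have hx0 (k) : x k ≠ 0 := by
    intro h0
    simpa [h0] using hunit k
  have hq (k) : x k ^ 3 ^ m = (x k)⁻¹ := eq_inv_of_mul_eq_one_left (by rw [← pow_succ, hunit])
  have hnine (k l) : x k ^ 9 - x l ^ 9 = (x k - x l) ^ 9 :=
    (sub_pow_char_pow (p := 3) (n := 2) (x k) (x l)).symm
  -- The extra factors cancel in the cross ratio, because each point occurs once above and once
  -- below.
  have hfrob (k l) : (x k - x l) ^ 3 ^ m = (x k - x l) * (-((x k)⁻¹ * (x l)⁻¹)) := by
    have := hx0 k
    have := hx0 l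
    rw [sub_pow_char_pow, hq, hq]
    field_simp
    ring
  have hcr := cross_ratio_eq_of_bilinear h x (fun k => x k ^ 9)
    (fun k => by linear_combination hx k)
  simp only [hnine] at hcr
  have h01 := hne (show (0 : Fin 4) ≠ 1 by decide)
  have h02 := hne (show (0 : Fin 4) ≠ 2 by decide)
  have h03 := hne (show (0 : Fin 4) ≠ 3 by decide)
  have h12 := hne (show (1 : Fin 4) ≠ 2 by decide)
  have h13 := hne (show (1 : Fin 4) ≠ 3 by decide)
  have h23 := hne (show (2 : Fin 4) ≠ 3 by decide)
  set t : E := (x 0 - x 1) * (x 2 - x 3) / ((x 0 - x 2) * (x 1 - x 3)) with ht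
  have ht0 : t ≠ 0 := div_ne_zero (mul_ne_zero h01 h23) (mul_ne_zero h02 h13)
  have ht1 : t ≠ 1 := by
    rw [ht, Ne, div_eq_one_iff_eq (mul_ne_zero h02 h13)]
    intro h
    exact mul_ne_zero h03 h12 (by linear_combination -h)
  have h9 : t ^ 9 = t := by
    rw [ht, div_pow, div_eq_div_iff (pow_ne_zero _ (mul_ne_zero h02 h13)) (mul_ne_zero h02 h13)]
    linear_combination -hcr
  have htq : t ^ 3 ^ m = t := by
    have := hx0 0
    have := hx0 1
    have := hx0 2
    have := hx0 3
    rw [ht, div_pow, mul_pow, mul_pow, hfrob, hfrob, hfrob, hfrob]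
    field_simp
  have h3 := cube_eq_of_pow_nine_eq hm h9 htq
  have hmul : t * (t - 1) * (t + 1) = 0 := by linear_combination h3
  have hneg : t + 1 = 0 := by
    simpa [ht0, sub_eq_zero, ht1] using hmul
  have h02_13 := mul_ne_zero h02 h13
  rw [ht, div_add_one h02_13, div_eq_zero_iff] at hneg
  exact hneg.resolve_right h02_13

/-- A nonzero polynomial `A + Bx + Cx⁹ + Dx¹⁰` has at most four zeros in the group of
`(3 ^ m + 1)`-th roots of unity. -/
theorem card_le_four_of_bilinear_frobenius {E : Type*} [Field E] [CharP E 3] {m : ℕ} (hm : Odd m)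
    {A B C D : E} (h : ¬ (A = 0 ∧ B = 0 ∧ C = 0 ∧ D = 0)) (s : Finset E)
    (hunit : ∀ x ∈ s, x ^ (3 ^ m + 1) = 1)
    (hx : ∀ x ∈ s, A + B * x + C * x ^ 9 + D * x ^ 10 = 0) : s.card ≤ 4 := by
  by_contra! hcard
  obtain ⟨f⟩ := Function.Embedding.nonempty_of_card_le (α := Fin 5) (β := s)
    (by simpa using Nat.succ_le_of_lt hcard)
  set x : Fin 5 → E := fun k => (f k : E) with hxdef
  have hinj : Function.Injective x := Subtype.val_injective.comp f.injective
  have key (g : Fin 4 → Fin 5) (hg : Function.Injective g) :=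
    harmonic_of_bilinear_frobenius hm h (x ∘ g) (hinj.comp hg) (fun k => hunit _ (f (g k)).2)
      (fun k => hx _ (f (g k)).2)
  have h1 := key ![0, 1, 2, 3] (by decide)
  have h2 := key ![0, 1, 2, 4] (by decide)
  simp only [Function.comp, Matrix.cons_val] at h1 h2
  have hne {k l : Fin 5} (hkl : k ≠ l) : x k - x l ≠ 0 := sub_ne_zero.2 (hinj.ne hkl)
  have h34 := hne (show (3 : Fin 5) ≠ 4 by decide)
  have h01 := hne (show (0 : Fin 5) ≠ 1 by decide)
  have h12 := hne (show (1 : Fin 5) ≠ 2 by decide)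
  -- The harmonic relation is affine in its last point; two distinct solutions make its slope
  -- vanish, and the constant term then forces two of the first three points to coincide.
  have hmid : (x 0 - x 1) + (x 0 - x 2) = 0 := by
    refine (mul_eq_zero.1 (?_ : (x 3 - x 4) * _ = 0)).resolve_left h34
    linear_combination h2 - h1
  exact mul_ne_zero h01 h12 (by linear_combination (x 1 - x 3) * hmid - h1)

/-! ### Roots of unity of order q + 1. -/

section RootsOfUnity

variable {E : Type*} [Field E]

theorem four_dvd_three_pow_add_one {m : ℕ} (hm : Odd m) : 4 ∣ 3 ^ m + 1 := by
  simpa using hm.nat_add_dvd_pow_add_pow 3 1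

theorem IsPrimitiveRoot.sq_quarter {β : E} {N : ℕ} (hN : 0 < N) (hβ : IsPrimitiveRoot β (4 * N)) :
    (β ^ N) ^ 2 = -1 := by
  have h4 : IsPrimitiveRoot (β ^ N) 4 := hβ.pow (by omega) (mul_comm 4 N)
  have h2 : IsPrimitiveRoot ((β ^ N) ^ 2) 2 := h4.pow (by norm_num) (by norm_num)
  exact h2.eq_neg_one_of_two_right

theorem IsPrimitiveRoot.injective_pow_fin {β : E} {n : ℕ} (hβ : IsPrimitiveRoot β n) :
    Function.Injective fun j : Fin n => β ^ (j : ℕ) :=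
  fun j k h => Fin.ext (hβ.pow_inj j.2 k.2 h)

theorem IsPrimitiveRoot.pow_fin_pow {β : E} {n : ℕ} (hβ : IsPrimitiveRoot β n) (j : Fin n) :
    (β ^ (j : ℕ)) ^ n = 1 := by
  rw [← pow_mul, mul_comm, pow_mul, hβ.pow_eq_one, one_pow]

theorem card_zeros_le_four [DecidableEq E] [CharP E 3] {m : ℕ} (hm : Odd m) {β : E}
    (hβ : IsPrimitiveRoot β (3 ^ m + 1)) {A A' D D' : E}
    (h : ¬ (A = 0 ∧ A' = 0 ∧ D = 0 ∧ D' = 0)) :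
    (Finset.univ.filter fun j : Fin (3 ^ m + 1) =>
      A * (β ^ (j : ℕ)) ^ 4 + A' * ((β ^ (j : ℕ))⁻¹) ^ 4 +
        D * (β ^ (j : ℕ)) ^ 5 + D' * ((β ^ (j : ℕ))⁻¹) ^ 5 = 0).card ≤ 4 := by
  rw [← Finset.card_image_of_injective _ hβ.injective_pow_fin]
  refine card_le_four_of_bilinear_frobenius hm (A := D') (B := A') (C := A) (D := D)
    (by tauto) _ ?_ ?_
  · intro x hx
    obtain ⟨j, -, rfl⟩ := Finset.mem_image.1 hx
    exact hβ.pow_fin_pow j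
  · intro x hx
    obtain ⟨j, hj, rfl⟩ := Finset.mem_image.1 hx
    have h0 : β ^ (j : ℕ) ≠ 0 := pow_ne_zero _ (hβ.ne_zero (Nat.succ_ne_zero _))
    have hj := (Finset.mem_filter.1 hj).2
    field_simp at hj
    linear_combination hj

end RootsOfUnity

/-! ### Weights in the code and conjugate parity checks. -/

section Code

variable {F : Type*} [Field F] {E : Type*} [Field E] [Algebra F E] {β : E}

/-- The conjugate of a parity check `∑ cⱼ xⱼᵏ = 0` with `xⱼ ^ q = xⱼ⁻¹`. -/
theorem sum_mul_inv_pow_eq_zero [Fintype F] [CharP E 3] {m : ℕ} (hF : Fintype.card F = 3 ^ m)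
    {ι : Type*} [Fintype ι] (x : ι → E) (hx : ∀ j, x j ^ (3 ^ m + 1) = 1) (c : ι → F) (k : ℕ)
    (h : ∑ j, algebraMap F E (c j) * x j ^ k = 0) :
    ∑ j, algebraMap F E (c j) * (x j)⁻¹ ^ k = 0 := by
  have : Fact (Nat.Prime 3) := ⟨Nat.prime_three⟩
  have h' : (∑ j, algebraMap F E (c j) * x j ^ k) ^ 3 ^ m = 0 ^ 3 ^ m := by rw [h]
  rw [zero_pow (by positivity), sum_pow_char_pow] at h'
  rw [← h']
  refine Finset.sum_congr rfl fun j _ => ?_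
  have hq : x j ^ 3 ^ m = (x j)⁻¹ := eq_inv_of_mul_eq_one_left (by rw [← pow_succ, hx])
  rw [mul_pow, ← map_pow, ← hF, FiniteField.pow_card, hF, ← pow_mul, mul_comm k, pow_mul, hq]

theorem four_le_hammingNorm [DecidableEq F] [CharP E 3] {n : ℕ} (hn : 3 ≤ n) (x : Fin n → E)
    (hinj : Function.Injective x) (hx0 : ∀ j, x j ≠ 0) {c : Fin n → F} (hc : c ≠ 0)
    (h4 : ∑ j, algebraMap F E (c j) * x j ^ 4 = 0) (h5 : ∑ j, algebraMap F E (c j) * x j ^ 5 = 0)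
    (h4' : ∑ j, algebraMap F E (c j) * (x j)⁻¹ ^ 4 = 0)
    (h5' : ∑ j, algebraMap F E (c j) * (x j)⁻¹ ^ 5 = 0) : 4 ≤ hammingNorm c := by
  by_contra! hlt
  obtain ⟨i, hi⟩ := Function.ne_iff.1 hc
  set s : Finset (Fin n) := Finset.univ.filter fun j => c j ≠ 0 with hs
  have his : i ∈ s := by simpa [hs] using hi
  have hcard : (s.erase i).card ≤ 2 := by
    have h : s.card < 4 := hlt
    rw [Finset.card_erase_of_mem his]
    omega
  -- The rest of the support is padded to exactly two positions, still avoiding i.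
  obtain ⟨t, hst, ht, ht2⟩ := Finset.exists_subsuperset_card_eq
    (Finset.erase_subset_erase i (Finset.subset_univ s)) hcard (by simp; omega)
  obtain ⟨a, b, -, rfl⟩ := Finset.card_eq_two.1 ht2
  have hai : a ≠ i := (Finset.mem_erase.1 (ht (by simp))).1
  have hbi : b ≠ i := (Finset.mem_erase.1 (ht (by simp))).1
  have : Fact (Nat.Prime 3) := ⟨Nat.prime_three⟩
  -- In characteristic 3 the ninth power is additive, so only the exponents 5, 4, -4, -5 appear.
  have hsum : ∑ j, algebraMap F E (c j) * ((x j)⁻¹ ^ 5 * ((x j - x a) * (x j - x b) ^ 9)) = 0 := by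
    have hterm (j : Fin n) : algebraMap F E (c j) * ((x j)⁻¹ ^ 5 * ((x j - x a) * (x j - x b) ^ 9)) =
        algebraMap F E (c j) * x j ^ 5 - x a * (algebraMap F E (c j) * x j ^ 4)
          - x b ^ 9 * (algebraMap F E (c j) * (x j)⁻¹ ^ 4)
          + x a * x b ^ 9 * (algebraMap F E (c j) * (x j)⁻¹ ^ 5) := by
      have hnine : (x j - x b) ^ 9 = x j ^ 9 - x b ^ 9 :=
        sub_pow_char_pow (p := 3) (n := 2) (x j) (x b)
      have := hx0 j
      rw [hnine]
      field_simp
      ring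
    simp only [hterm, Finset.sum_add_distrib, Finset.sum_sub_distrib, ← Finset.mul_sum,
      h4, h5, h4', h5']
    ring
  rw [Finset.sum_eq_single i] at hsum
  · have hne : x i - x a ≠ 0 ∧ x i - x b ≠ 0 :=
      ⟨sub_ne_zero.2 (hinj.ne hai.symm), sub_ne_zero.2 (hinj.ne hbi.symm)⟩
    have hci : algebraMap F E (c i) ≠ 0 := by simpa using hi
    exact mul_ne_zero hci (mul_ne_zero (pow_ne_zero _ (inv_ne_zero (hx0 i)))
      (mul_ne_zero hne.1 (pow_ne_zero _ hne.2))) hsum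
  · intro j _ hji
    by_cases hj : c j = 0
    · simp [hj]
    · have : j ∈ ({a, b} : Finset (Fin n)) := hst (by simp [hs, hj, hji])
      rcases Finset.mem_insert.1 this with rfl | hjb
      · simp
      · rw [Finset.mem_singleton.1 hjb]
        simp
  · simp

/-- The four positions `0, N, 2N, 3N` in a word of length `4N`. -/
def quarterPos {N : ℕ} (hN : 0 < N) (k : Fin 4) : Fin (4 * N) :=
  ⟨k * N, Nat.mul_lt_mul_of_pos_right k.2 hN⟩

theorem quarterPos_injective {N : ℕ} (hN : 0 < N) : Function.Injective (quarterPos hN) := by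
  intro k l h
  exact Fin.ext (Nat.eq_of_mul_eq_mul_right hN (congrArg Fin.val h))

theorem exists_hammingNorm_le_four [DecidableEq F] {N : ℕ} (hN : 0 < N)
    (hβ : IsPrimitiveRoot β (4 * N)) : ∃ c : Fin (4 * N) → F, c ≠ 0 ∧ hammingNorm c ≤ 4 ∧
      ∑ j, algebraMap F E (c j) * (β ^ (j : ℕ)) ^ 4 = 0 ∧
      ∑ j, algebraMap F E (c j) * (β ^ (j : ℕ)) ^ 5 = 0 := by
  have hinj := quarterPos_injective hN
  -- At the points 1, ζ, -1, -ζ with ζ = β^N, one has x^4 = 1 and x^5 = x, so the alternating signs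
  -- cancel both checks.
  set c : Fin (4 * N) → F := Function.extend (quarterPos hN) ![1, -1, 1, -1] 0 with hc
  have hin (k : Fin 4) : c (quarterPos hN k) = ![1, -1, 1, -1] k := hinj.extend_apply ..
  have hout (j) (hj : j ∉ Finset.univ.image (quarterPos hN)) : c j = 0 :=
    Function.extend_apply' _ _ _ (by simpa using hj)
  have hsum (l : ℕ) : ∑ j, algebraMap F E (c j) * (β ^ (j : ℕ)) ^ l =
      1 - (β ^ N) ^ l + (β ^ N) ^ (2 * l) - (β ^ N) ^ (3 * l) := by
    rw [← Finset.sum_subset (Finset.subset_univ (Finset.univ.image (quarterPos hN)))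
      (fun j _ hj => by simp [hout j hj]), Finset.sum_image hinj.injOn, Fin.sum_univ_four]
    simp only [hin]
    simp [quarterPos]
    ring
  have hsq := hβ.sq_quarter hN
  refine ⟨c, fun h0 => ?_, ?_, ?_, ?_⟩
  · have := hin 0
    simp [h0] at this
  · calc hammingNorm c ≤ (Finset.univ.image (quarterPos hN)).card := by
          refine Finset.card_le_card fun j hj => ?_
          by_contra h
          exact (Finset.mem_filter.1 hj).2 (hout j h)
      _ ≤ 4 := Finset.card_image_le
  · rw [hsum]
    generalize β ^ N = t at *
    linear_combination -(1 + t ^ 8) * (t ^ 2 - 1) * hsq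
  · rw [hsum]
    generalize β ^ N = t at *
    have h4 : t ^ 4 = 1 := by linear_combination (t ^ 2 - 1) * hsq
    rw [show t ^ 5 = t ^ 4 * t by ring, show t ^ (2 * 5) = (t ^ 4) ^ 2 * t ^ 2 by ring,
      show t ^ (3 * 5) = (t ^ 4) ^ 3 * (t ^ 2 * t) by ring, h4, hsq]
    ring

/-- Parity checks, with values in `E`, whose entries are fixed by the Frobenius of `F`
when `ζ ^ q = -ζ` and `x ^ q = x⁻¹`. -/
def conjugateRow (ζ x : E) : Fin 4 → E :=
  ![x ^ 4 + x⁻¹ ^ 4, ζ * (x ^ 4 - x⁻¹ ^ 4), x ^ 5 + x⁻¹ ^ 5, ζ * (x ^ 5 - x⁻¹ ^ 5)]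

theorem conjugateRow_pow [CharP E 3] {m : ℕ} {ζ x : E} (hζ : ζ ^ 3 ^ m = -ζ)
    (hx : x ^ (3 ^ m + 1) = 1) (l : Fin 4) :
    conjugateRow ζ x l ^ 3 ^ m = conjugateRow ζ x l := by
  have : Fact (Nat.Prime 3) := ⟨Nat.prime_three⟩
  have hq : x ^ 3 ^ m = x⁻¹ := eq_inv_of_mul_eq_one_left (by rw [← pow_succ, hx])
  have hk (k : ℕ) : (x ^ k) ^ 3 ^ m = x⁻¹ ^ k := by rw [← pow_mul, mul_comm, pow_mul, hq]
  have hk' (k : ℕ) : (x⁻¹ ^ k) ^ 3 ^ m = x ^ k := by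
    rw [← pow_mul, mul_comm, pow_mul, inv_pow, hq, inv_inv]
  fin_cases l <;> simp only [conjugateRow, Fin.mk_one, Fin.zero_eta, Fin.reduceFinMk,
    Matrix.cons_val, mul_pow ζ, add_pow_char_pow, sub_pow_char_pow, hk, hk', hζ] <;> ring

theorem sum_conjugateRow_eq_zero_iff (h2 : (2 : E) ≠ 0) {ζ : E} (hζ : ζ ≠ 0) {ι : Type*}
    [Fintype ι] (x : ι → E) (c : ι → E) :
    (∀ l, ∑ j, conjugateRow ζ (x j) l * c j = 0) ↔
      ((∑ j, c j * x j ^ 4 = 0 ∧ ∑ j, c j * (x j)⁻¹ ^ 4 = 0) ∧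
        (∑ j, c j * x j ^ 5 = 0 ∧ ∑ j, c j * (x j)⁻¹ ^ 5 = 0)) := by
  have hadd (k : ℕ) : ∑ j, (x j ^ k + (x j)⁻¹ ^ k) * c j =
      ∑ j, c j * x j ^ k + ∑ j, c j * (x j)⁻¹ ^ k := by
    rw [← Finset.sum_add_distrib]
    exact Finset.sum_congr rfl fun j _ => by ring
  have hsub (k : ℕ) : ∑ j, ζ * (x j ^ k - (x j)⁻¹ ^ k) * c j =
      ζ * (∑ j, c j * x j ^ k - ∑ j, c j * (x j)⁻¹ ^ k) := by
    rw [← Finset.sum_sub_distrib, Finset.mul_sum]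
    exact Finset.sum_congr rfl fun j _ => by ring
  have hpair (u v : E) : (u + v = 0 ∧ ζ * (u - v) = 0) ↔ (u = 0 ∧ v = 0) := by
    constructor
    · rintro ⟨h, h'⟩
      have h' := (mul_eq_zero.1 h').resolve_left hζ
      have hu : u = 0 := (mul_eq_zero.1 (by linear_combination h + h' : 2 * u = 0)).resolve_left h2
      exact ⟨hu, by simpa [hu] using h⟩
    · rintro ⟨rfl, rfl⟩
      simp
  rw [← hpair, ← hpair (∑ j, c j * x j ^ 5), ← hadd, ← hadd, ← hsub, ← hsub]
  constructor
  · exact fun h => ⟨⟨h 0, h 1⟩, h 2, h 3⟩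
  · rintro ⟨⟨h0, h1⟩, h2, h3⟩ l
    fin_cases l
    exacts [h0, h1, h2, h3]

end Code

/-! ### The span of the conjugate rows. -/

section ConjugateRow

variable {F : Type*} [Field F] [DecidableEq F] {E : Type*} [Field E] [Algebra F E]
  [CharP E 3] {m : ℕ} {β : E}

theorem card_zeros_conjugateRow_le_four (hm : Odd m) (hβ : IsPrimitiveRoot β (3 ^ m + 1)) {ζ : E}
    (hζ : ζ ≠ 0) (r : Fin 4 → Fin (3 ^ m + 1) → F)
    (hr : ∀ l j, algebraMap F E (r l j) = conjugateRow ζ (β ^ (j : ℕ)) l) {a : Fin 4 → F}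
    (ha : a ≠ 0) : (Finset.univ.filter fun j => (∑ l, a l • r l) j = 0).card ≤ 4 := by
  classical
  have h2 := two_ne_zero_of_charP_three E
  set b : Fin 4 → E := fun l => algebraMap F E (a l) with hb
  have hpair (u v : E) (h : u + ζ * v = 0) (h' : u - ζ * v = 0) : u = 0 ∧ v = 0 := by
    have hu : u = 0 := (mul_eq_zero.1 (by linear_combination h + h' : 2 * u = 0)).resolve_left h2
    exact ⟨hu, by simpa [hu, hζ] using h⟩
  have hcoef : ¬ (b 0 + ζ * b 1 = 0 ∧ b 0 - ζ * b 1 = 0 ∧ b 2 + ζ * b 3 = 0 ∧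
      b 2 - ζ * b 3 = 0) := by
    rintro ⟨h0, h1, h2, h3⟩
    obtain ⟨h0, h1⟩ := hpair _ _ h0 h1
    obtain ⟨h2, h3⟩ := hpair _ _ h2 h3
    refine ha (funext fun l => ?_)
    have hl : b l = 0 := by fin_cases l <;> assumption
    simpa [hb] using hl
  refine le_trans (Finset.card_le_card fun j hj => ?_) (card_zeros_le_four hm hβ hcoef)
  have hj := congrArg (algebraMap F E) (Finset.mem_filter.1 hj).2
  simp only [Finset.sum_apply, Pi.smul_apply, smul_eq_mul, map_add, map_mul, hr, map_zero,
    Fin.sum_univ_four] at hj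
  refine Finset.mem_filter.2 ⟨Finset.mem_univ _, ?_⟩
  simp only [conjugateRow, Matrix.cons_val] at hj
  linear_combination hj

theorem linearIndependent_of_conjugateRow (hm : Odd m) (hm3 : 3 ≤ m)
    (hβ : IsPrimitiveRoot β (3 ^ m + 1)) {ζ : E}
    (hζ : ζ ≠ 0) (r : Fin 4 → Fin (3 ^ m + 1) → F)
    (hr : ∀ l j, algebraMap F E (r l j) = conjugateRow ζ (β ^ (j : ℕ)) l) :
    LinearIndependent F r := by
  rw [Fintype.linearIndependent_iff]
  intro a ha
  by_contra! hne
  obtain ⟨l, hl⟩ := hne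
  have h := card_zeros_conjugateRow_le_four hm hβ hζ r hr (a := a) (fun h0 => hl (by simp [h0]))
  have : 3 ^ 3 ≤ 3 ^ m := Nat.pow_le_pow_right (by norm_num) hm3
  simp only [ha, Pi.zero_apply, Finset.filter_true, Finset.card_univ, Fintype.card_fin] at h
  omega

theorem isMinDistance_span_conjugateRow (hm : Odd m) (hm3 : 3 ≤ m)
    (hβ : IsPrimitiveRoot β (3 ^ m + 1)) {ζ : E}
    (hζ : ζ ≠ 0) (r : Fin 4 → Fin (3 ^ m + 1) → F)
    (hr : ∀ l j, algebraMap F E (r l j) = conjugateRow ζ (β ^ (j : ℕ)) l) :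
    IsMinDistance (Submodule.span F (Set.range r)) (3 ^ m - 3) := by
  rw [isMinDistance_iff_hammingNorm]
  have hlow (c) (hc : c ∈ Submodule.span F (Set.range r)) (h0 : c ≠ 0) :
      3 ^ m - 3 ≤ hammingNorm c := by
    obtain ⟨a, rfl⟩ := (Submodule.mem_span_range_iff_exists_fun F).1 hc
    have ha : a ≠ 0 := fun ha => h0 (by simp [ha])
    have := card_zeros_conjugateRow_le_four hm hβ hζ r hr ha
    have := hammingNorm_add_card_zeros (∑ l, a l • r l)
    omega
  refine ⟨?_, hlow⟩
  obtain ⟨N, hN⟩ := four_dvd_three_pow_add_one hm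
  have hN0 : 0 < N := by
    have : 0 < 3 ^ m + 1 := Nat.succ_pos _
    omega
  -- Row 1 is ζ(x^4 - x⁻⁴), which vanishes at all fourth roots of unity and so attains the bound.
  have hmem : r 1 ∈ Submodule.span F (Set.range r) := Submodule.subset_span ⟨1, rfl⟩
  have hzero : 4 ≤ (Finset.univ.filter fun j => r 1 j = 0).card := by
    set e : Fin 4 → Fin (3 ^ m + 1) := Fin.cast hN.symm ∘ quarterPos hN0 with he
    have hinj : Function.Injective e :=
      (Fin.cast_injective _).comp (quarterPos_injective hN0)
    have hcard : (Finset.univ.image e).card = 4 := by simp [Finset.card_image_of_injective _ hinj]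
    refine hcard.symm.le.trans (Finset.card_le_card fun j hj => ?_)
    obtain ⟨k, -, rfl⟩ := Finset.mem_image.1 hj
    refine Finset.mem_filter.2 ⟨Finset.mem_univ _, ?_⟩
    have hk : (β ^ (e k : ℕ)) ^ 4 = 1 := by
      have hval : (e k : ℕ) * 4 = (3 ^ m + 1) * k := by
        calc (e k : ℕ) * 4 = 4 * N * k := by
              simp only [he, quarterPos, Function.comp, Fin.val_cast]
              ring
          _ = (3 ^ m + 1) * k := by rw [hN]
      rw [← pow_mul, hval, pow_mul, hβ.pow_eq_one, one_pow]
    apply (algebraMap F E).injective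
    rw [hr, map_zero]
    simp only [conjugateRow, Matrix.cons_val, inv_pow, hk]
    simp
  have hsum := hammingNorm_add_card_zeros (r 1)
  have h0 : r 1 ≠ 0 := (linearIndependent_of_conjugateRow hm hm3 hβ hζ r hr).ne_zero 1
  exact ⟨r 1, hmem, h0, le_antisymm (by omega) (hlow _ hmem h0)⟩

end ConjugateRow

/-! ### Parameters of the code and its dual. -/

theorem mem_bchCode_three_four_iff {F : Type*} [Field F] {E : Type*} [Field E] [Algebra F E]
    {β : E} {n : ℕ} (hβ : β ^ n = 1) (hn : 5 < n) (c : Fin n → F) :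
    c ∈ bchCode F β n 3 4 ↔ ∑ j, algebraMap F E (c j) * (β ^ (j : ℕ)) ^ 4 = 0 ∧
      ∑ j, algebraMap F E (c j) * (β ^ (j : ℕ)) ^ 5 = 0 := by
  rw [mem_bchCode_iff hβ (by omega)]
  constructor
  · intro h
    have h0 := h 0 (by norm_num)
    have h1 := h 1 (by norm_num)
    rw [Nat.mod_eq_of_lt (by omega)] at h0 h1
    exact ⟨h0, h1⟩
  · rintro ⟨h0, h1⟩ l hl
    rw [Nat.mod_eq_of_lt (by omega)]
    interval_cases l
    exacts [h0, h1]

theorem theorem1p3 (m q : ℕ) (hm : 3 ≤ m) (hodd : Odd m) (hq : q = 3 ^ m)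
    (F : Type*) [Field F] [DecidableEq F] (hF : Nat.card F = q)
    (E : Type*) [Field E] [Algebra F E] (β : E) (hβ : IsPrimitiveRoot β (q + 1)) :
    IsNearMDS (bchCode F β (q + 1) 3 4) ∧
      IsLinearCode (q + 1) (q - 3) 4 (bchCode F β (q + 1) 3 4) := by
  subst hq
  have hlarge : 3 ^ 3 ≤ 3 ^ m := Nat.pow_le_pow_right (by norm_num) hm
  have : Finite F := Nat.finite_of_card_ne_zero (by rw [hF]; positivity)
  have : Fintype F := Fintype.ofFinite F
  rw [Nat.card_eq_fintype_card] at hF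
  have : Fact (Nat.Prime 3) := ⟨Nat.prime_three⟩
  have : CharP F 3 := charP_of_card_eq_prime_pow hF
  have : CharP E 3 := charP_of_injective_algebraMap (algebraMap F E).injective 3
  have h2 := two_ne_zero_of_charP_three E
  obtain ⟨N, hN⟩ := four_dvd_three_pow_add_one hodd
  have hN0 : 0 < N := by omega
  set ζ : E := β ^ N with hζdef
  have hζsq : ζ ^ 2 = -1 := IsPrimitiveRoot.sq_quarter hN0 (hN ▸ hβ)
  have hζ0 : ζ ≠ 0 := pow_ne_zero _ (hβ.ne_zero (Nat.succ_ne_zero _))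
  have hζq : ζ ^ 3 ^ m = -ζ := by
    have h1 : ζ ^ 3 ^ m * ζ = 1 := by
      rw [← pow_succ, hζdef, ← pow_mul, mul_comm, pow_mul, hβ.pow_eq_one, one_pow]
    exact mul_right_cancel₀ hζ0 (by linear_combination h1 + hζsq)
  have hx0 (j : Fin (3 ^ m + 1)) : β ^ (j : ℕ) ≠ 0 :=
    pow_ne_zero _ (hβ.ne_zero (Nat.succ_ne_zero _))
  have hrow (l : Fin 4) (j : Fin (3 ^ m + 1)) :
      ∃ a : F, algebraMap F E a = conjugateRow ζ (β ^ (j : ℕ)) l :=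
    mem_range_algebraMap_of_pow_card_eq (by
      rw [hF]
      exact conjugateRow_pow hζq (hβ.pow_fin_pow j) l)
  choose r hr using hrow
  set C := bchCode F β (3 ^ m + 1) 3 4 with hC
  have hmem (c : Fin (3 ^ m + 1) → F) := mem_bchCode_three_four_iff hβ.pow_eq_one (by omega) c
  have hdual : C = dualCode (Submodule.span F (Set.range r)) := by
    ext c
    have hcast : (∀ l, ∑ j, r l j * c j = 0) ↔
        ∀ l, ∑ j : Fin (3 ^ m + 1), conjugateRow ζ (β ^ (j : ℕ)) l * algebraMap F E (c j) = 0 := by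
      refine forall_congr' fun l => ?_
      rw [← map_eq_zero (algebraMap F E)]
      simp only [map_sum, map_mul, hr]
    rw [mem_dualCode_span_range, hcast,
      sum_conjugateRow_eq_zero_iff h2 hζ0 (fun j : Fin (3 ^ m + 1) => β ^ (j : ℕ)), hmem]
    -- The checks at exponents -4 and -5 are Frobenius conjugates of those at 4 and 5, hence
    -- automatic.
    have hconj := sum_mul_inv_pow_eq_zero hF (fun j : Fin (3 ^ m + 1) => β ^ (j : ℕ))
      hβ.pow_fin_pow c
    exact ⟨fun h => ⟨⟨h.1, hconj 4 h.1⟩, h.2, hconj 5 h.2⟩, fun h => ⟨h.1.1, h.2.1⟩⟩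
  have hspan : dualCode C = Submodule.span F (Set.range r) := by rw [hdual, dualCode_dualCode]
  have hfin : Module.finrank F (Submodule.span F (Set.range r)) = 4 := by
    rw [finrank_span_eq_card (linearIndependent_of_conjugateRow hodd hm hβ hζ0 r hr),
      Fintype.card_fin]
  have hweight (c) (hc : c ∈ C) (h0 : c ≠ 0) : 4 ≤ hammingNorm c := by
    obtain ⟨h4, h5⟩ := (hmem c).1 hc
    have hconj := sum_mul_inv_pow_eq_zero hF (fun j : Fin (3 ^ m + 1) => β ^ (j : ℕ))
      hβ.pow_fin_pow c
    exact four_le_hammingNorm (by omega) _ hβ.injective_pow_fin hx0 h0 h4 h5 (hconj 4 h4)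
      (hconj 5 h5)
  have hmin : IsMinDistance C 4 := by
    rw [isMinDistance_iff_hammingNorm]
    refine ⟨?_, hweight⟩
    have hex := exists_hammingNorm_le_four (F := F) hN0 (hN ▸ hβ)
    rw [← hN] at hex
    obtain ⟨c, h0, hle, h⟩ := hex
    exact ⟨c, (hmem c).2 h, h0, le_antisymm hle (hweight c ((hmem c).2 h) h0)⟩
  have hcode : IsLinearCode (3 ^ m + 1) (3 ^ m - 3) 4 C := by
    refine ⟨?_, hmin⟩
    rw [hdual, finrank_dualCode, hfin]
    omega
  refine ⟨⟨⟨_, _, hcode, by omega⟩, 4, 3 ^ m - 3, ⟨?_, ?_⟩, by omega⟩, hcode⟩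
  · rw [hspan, hfin]
  · rw [hspan]
    exact isMinDistance_span_conjugateRow hodd hm hβ hζ0 r hr
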